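/- Let $\hat f(\xi)=\int_{\mathbb R}e^{-ix\xi}f(x)\,dx$ denote the Fourier transform on $L^2(\mathbb R)$, let $H^+$ be the Hardy space of all $f\in L^2(\mathbb R)$ whose Fourier transform vanishes almost everywhere on $(-\infty,0)$, and let $C_+:L^2(\mathbb R)\to H^+$ be the Cauchy projection, $\widehat{C_+f}=\chi_{(0,\infty)}\hat f$. Let $u:\mathbb R\to\mathbb R$ be a real-valued function with $u\in L^2(\mathbb R)\cap L^\infty(\mathbb R)$ and $xu(x)\in L^2(\mathbb R)$, and let $L_u$ be the operator on $H^+$ with domain $H^+\cap H^1(\mathbb R)$ given by $$L_u\varphi=\frac1i\,\partial_x\varphi-C_+(u\,C_+\varphi).$$ If $\lambda<0$ is an eigenvalue of $L_u$ and $\varphi$ is an eigenvector for $\lambda$ (that is, $\varphi\ne0$ lies in the domain of $L_u$ and $L_u\varphi=\lambda\varphi$), then $u\varphi$ is integrable and $$\left|\int_{\mathbb R}u\varphi\,dx\right|^2=2\pi|\lambda|\int_{\mathbb R}|\varphi|^2\,dx .$$ In particular $\int_{\mathbb R}u\varphi\,dx\neq0$. -/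

import Mathlib

open MeasureTheory FourierTransform SchwartzMap
open scoped ENNReal LineDeriv

noncomputable section

namespace BenjaminOno

/-- The complex Hilbert space `L²(ℝ)`. -/
abbrev L2 : Type := Lp ℂ 2 (volume : Measure ℝ)

/-- Multiplication by an essentially bounded function, as an operator on `L²(ℝ)`. -/
def mulOp (m : ℝ → ℂ) (hm : MemLp m ∞ volume) : L2 →L[ℂ] L2 :=
  (ContinuousLinearMap.mul ℂ ℂ).holderL volume ∞ 2 2 (hm.toLp m)

theorem mulOp_ae (m : ℝ → ℂ) (hm : MemLp m ∞ volume) (φ : L2) :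
    mulOp m hm φ =ᵐ[volume] fun x => m x * φ x := by
  have h := (ContinuousLinearMap.mul ℂ ℂ).coeFn_holder (r := 2) (hm.toLp m) φ
  filter_upwards [h, hm.coeFn_toLp] with x hx hx'
  rw [← hx']
  exact hx

/-- The Hardy space `H⁺`: the `L²` functions whose Fourier transform is supported on the positive
half line. Here and below `𝓕 f (ξ) = ∫ exp (-2πixξ) f(x) dx`; this is the transform
`∫ exp (-ixξ) f(x) dx` up to a dilation by the positive factor `2π`, which preserves half lines. -/
def hardyPlus : Submodule ℂ L2 where
  carrier := {f | ∀ᵐ ξ : ℝ, ξ < 0 → (𝓕 f : L2) ξ = 0}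
  zero_mem' := by
    change ∀ᵐ ξ : ℝ, ξ < 0 → (𝓕 (0 : L2) : L2) ξ = 0
    have h0 : (𝓕 (0 : L2) : L2) = 0 := (Lp.fourierTransformₗᵢ ℝ ℂ).map_zero
    rw [h0]
    filter_upwards [Lp.coeFn_zero ℂ 2 (volume : Measure ℝ)] with ξ hξ _
    exact hξ
  add_mem' := by
    intro f g hf hg
    change ∀ᵐ ξ : ℝ, ξ < 0 → (𝓕 (f + g) : L2) ξ = 0
    rw [FourierTransform.fourier_add]
    filter_upwards [Lp.coeFn_add (𝓕 f : L2) (𝓕 g : L2), hf, hg] with ξ h h1 h2 hξ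
    rw [h, Pi.add_apply, h1 hξ, h2 hξ, add_zero]
  smul_mem' := by
    intro c f hf
    change ∀ᵐ ξ : ℝ, ξ < 0 → (𝓕 (c • f) : L2) ξ = 0
    rw [FourierTransform.fourier_smul]
    filter_upwards [Lp.coeFn_smul c (𝓕 f : L2), hf] with ξ h h1 hξ
    rw [h, Pi.smul_apply, h1 hξ, smul_zero]

/-- The indicator function of the positive half line. -/
def posIndicator : ℝ → ℂ := Set.indicator (Set.Ioi 0) 1

theorem memLp_posIndicator : MemLp posIndicator ∞ volume :=
  (memLp_top_const (1 : ℂ)).indicator measurableSet_Ioi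

/-- The Cauchy projection `C₊ : L² → H⁺`, the Fourier multiplier with symbol `χ_{(0,∞)}`. -/
def cauchyPlus : L2 →ₗ[ℂ] hardyPlus where
  toFun φ := ⟨𝓕⁻ (mulOp posIndicator memLp_posIndicator (𝓕 φ)), by
    change ∀ᵐ ξ : ℝ, ξ < 0 → (𝓕 (𝓕⁻ (mulOp posIndicator memLp_posIndicator (𝓕 φ))) : L2) ξ = 0
    rw [FourierTransform.fourier_fourierInv_eq]
    filter_upwards [mulOp_ae posIndicator memLp_posIndicator (𝓕 φ)] with ξ h hξ
    rw [h, posIndicator, Set.indicator_of_notMem (by simpa using hξ.le), zero_mul]⟩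
  map_add' φ ψ := by
    ext1
    simp [FourierTransform.fourier_add, FourierTransform.fourierInv_add]
  map_smul' c φ := by
    ext1
    simp [FourierTransform.fourier_smul, FourierTransform.fourierInv_smul]

/-- The Sobolev space `H¹(ℝ)` as a subspace of `L²(ℝ)`. -/
def sobolevOne : Submodule ℂ L2 where
  carrier := {f | TemperedDistribution.MemSobolev 1 2 (f : 𝓢'(ℝ, ℂ))}
  zero_mem' := by
    change TemperedDistribution.MemSobolev 1 2 (Lp.toTemperedDistributionCLM ℂ volume 2 0)
    rw [map_zero]
    exact TemperedDistribution.memSobolev_fun_zero ℝ ℂ 1 2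
  add_mem' := by
    intro f g hf hg
    change TemperedDistribution.MemSobolev 1 2 (Lp.toTemperedDistributionCLM ℂ volume 2 (f + g))
    rw [map_add]
    exact hf.add hg
  smul_mem' := by
    intro c f hf
    change TemperedDistribution.MemSobolev 1 2 (Lp.toTemperedDistributionCLM ℂ volume 2 (c • f))
    rw [map_smul]
    exact hf.smul c

theorem exists_weakDeriv (f : sobolevOne) :
    ∃ g : L2, ∂_{(1 : ℝ)} ((f : L2) : 𝓢'(ℝ, ℂ)) = (g : 𝓢'(ℝ, ℂ)) := by
  have h := TemperedDistribution.MemSobolev.lineDerivOp (m := (1 : ℝ)) f.2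
  rw [sub_self] at h
  exact TemperedDistribution.memSobolev_zero_iff.1 h

theorem toTemperedDistribution_injective {f g : L2}
    (h : (f : 𝓢'(ℝ, ℂ)) = (g : 𝓢'(ℝ, ℂ))) : f = g :=
  LinearMap.ker_eq_bot.1 Lp.ker_toTemperedDistributionCLM_eq_bot h

/-- The derivative `∂ₓ : H¹(ℝ) → L²(ℝ)`: the `L²` function that represents the distributional
derivative. -/
def weakDeriv : sobolevOne →ₗ[ℂ] L2 where
  toFun f := (exists_weakDeriv f).choose
  map_add' f g := by
    apply toTemperedDistribution_injective
    rw [← (exists_weakDeriv (f + g)).choose_spec]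
    change ∂_{(1 : ℝ)} (Lp.toTemperedDistributionCLM ℂ volume 2 ((f : L2) + (g : L2))) =
      Lp.toTemperedDistributionCLM ℂ volume 2 _
    rw [map_add, map_add, LineDeriv.lineDerivOp_add]
    exact congrArg₂ _ (exists_weakDeriv f).choose_spec (exists_weakDeriv g).choose_spec
  map_smul' c f := by
    apply toTemperedDistribution_injective
    rw [← (exists_weakDeriv (c • f)).choose_spec]
    change ∂_{(1 : ℝ)} (Lp.toTemperedDistributionCLM ℂ volume 2 (c • (f : L2))) =
      Lp.toTemperedDistributionCLM ℂ volume 2 _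
    rw [RingHom.id_apply, map_smul, map_smul, LineDeriv.lineDerivOp_smul]
    exact congrArg _ (exists_weakDeriv f).choose_spec

theorem weakDeriv_spec (f : sobolevOne) :
    ∂_{(1 : ℝ)} ((f : L2) : 𝓢'(ℝ, ℂ)) = (weakDeriv f : 𝓢'(ℝ, ℂ)) :=
  (exists_weakDeriv f).choose_spec

theorem fourier_weakDeriv_ae (f : sobolevOne) :
    (𝓕 (weakDeriv f) : L2) =ᵐ[volume]
      fun ξ : ℝ => (2 * Real.pi * Complex.I * ξ) * (𝓕 (f : L2) : L2) ξ := by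
  have key : ((𝓕 (weakDeriv f) : L2) : 𝓢'(ℝ, ℂ)) =
      (2 * Real.pi * Complex.I) • TemperedDistribution.smulLeftCLM ℂ
        (fun ξ : ℝ => ((inner ℝ ξ (1 : ℝ) : ℝ) : ℂ)) ((𝓕 (f : L2) : L2) : 𝓢'(ℝ, ℂ)) := by
    rw [← Lp.fourier_toTemperedDistribution_eq, ← weakDeriv_spec,
      TemperedDistribution.fourier_lineDerivOp_eq, Lp.fourier_toTemperedDistribution_eq]
  have hloc : ∀ g : L2, LocallyIntegrable g volume := fun g =>
    (Lp.memLp g).locallyIntegrable (by norm_num)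
  have hcont : Continuous fun ξ : ℝ => 2 * (Real.pi : ℂ) * Complex.I * (ξ : ℂ) := by fun_prop
  apply ae_eq_of_integral_contDiff_smul_eq (hloc _)
  · exact LocallyIntegrable.continuous_mul hcont (hloc _)
  · intro g hg hgc
    have hsm : ContDiff ℝ (⊤ : ℕ∞) (fun x : ℝ => (g x : ℂ)) := Complex.ofRealCLM.contDiff.comp hg
    have hsc : HasCompactSupport (fun x : ℝ => (g x : ℂ)) :=
      hgc.comp_left (g := fun y : ℝ => (y : ℂ)) Complex.ofReal_zero
    have h := congrArg (fun T : 𝓢'(ℝ, ℂ) => T (hsc.toSchwartzMap hsm)) key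
    have hin : (fun ξ : ℝ => ((inner ℝ ξ (1 : ℝ) : ℝ) : ℂ)).HasTemperateGrowth := by fun_prop
    calc ∫ x, g x • (𝓕 (weakDeriv f) : L2) x
        = ((𝓕 (weakDeriv f) : L2) : 𝓢'(ℝ, ℂ)) (hsc.toSchwartzMap hsm) := by
          rw [Lp.toTemperedDistribution_apply]
          simp
      _ = (2 * Real.pi * Complex.I) * ∫ x : ℝ, ((x : ℂ) * (g x : ℂ)) * (𝓕 (f : L2) : L2) x := by
          refine h.trans ?_
          change (2 * Real.pi * Complex.I) • (((𝓕 (f : L2) : L2) : 𝓢'(ℝ, ℂ))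
            (SchwartzMap.smulLeftCLM ℂ _ (hsc.toSchwartzMap hsm))) = _
          rw [Lp.toTemperedDistribution_apply, smul_eq_mul]
          simp_rw [SchwartzMap.smulLeftCLM_apply_apply hin]
          simp
      _ = _ := by
          rw [← integral_const_mul]
          congr 1
          ext x
          rw [Complex.real_smul]
          ring

theorem weakDeriv_mem_hardyPlus (f : sobolevOne) (hf : (f : L2) ∈ hardyPlus) :
    weakDeriv f ∈ hardyPlus := by
  change ∀ᵐ ξ : ℝ, ξ < 0 → (𝓕 (weakDeriv f) : L2) ξ = 0
  filter_upwards [fourier_weakDeriv_ae f, hf] with ξ h h0 hξ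
  simp [h, h0 hξ]

/-- The operator `-i ∂ₓ` on `H⁺`, with domain `H⁺ ∩ H¹(ℝ)`. -/
def momentum : hardyPlus →ₗ.[ℂ] hardyPlus where
  domain := sobolevOne.comap hardyPlus.subtype
  toFun := (1 / Complex.I) •
    (weakDeriv ∘ₗ hardyPlus.subtype.restrict fun _ h => h).codRestrict hardyPlus
      fun φ => weakDeriv_mem_hardyPlus _ φ.1.2

/-- The Toeplitz operator `φ ↦ C₊ (u C₊ φ)` on `H⁺`. -/
def toeplitz (u : ℝ → ℝ) (hu : MemLp u ∞ volume) : hardyPlus →ₗ[ℂ] hardyPlus :=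
  cauchyPlus ∘ₗ (mulOp (fun x => (u x : ℂ)) hu.ofReal).toLinearMap ∘ₗ
    hardyPlus.subtype ∘ₗ cauchyPlus ∘ₗ hardyPlus.subtype

/-- The Lax operator `L_u φ = -i ∂ₓ φ - C₊ (u C₊ φ)` of the Benjamin–Ono equation: an unbounded
operator on `H⁺` with domain `H⁺ ∩ H¹(ℝ)`. -/
def laxOp (u : ℝ → ℝ) (hu : MemLp u ∞ volume) : hardyPlus →ₗ.[ℂ] hardyPlus where
  domain := momentum.domain
  toFun := momentum.toFun - toeplitz u hu ∘ₗ momentum.domain.subtype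

/-- `φ` is an eigenvector of the unbounded operator `T` with eigenvalue `z`: it is a nonzero element
of the domain of `T` with `T φ = z φ`. -/
def IsEigenvector {E : Type*} [AddCommGroup E] [Module ℂ E] (T : E →ₗ.[ℂ] E) (z : ℂ) (φ : E) :
    Prop :=
  φ ≠ 0 ∧ ∃ h : φ ∈ T.domain, T ⟨φ, h⟩ = z • φ

end BenjaminOno

end

namespace BenjaminOno

open Filter Topology ComplexConjugate

theorem ae_eq_of_forall_integral_schwartz_mul_eq {f : L2} {g : ℝ → ℂ} (hg : Continuous g)
    (h : ∀ s : 𝓢(ℝ, ℂ), (f : 𝓢'(ℝ, ℂ)) s = ∫ x, s x * g x) : f =ᵐ[volume] g := by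
  apply ae_eq_of_integral_contDiff_smul_eq ((Lp.memLp f).locallyIntegrable (by norm_num))
    hg.locallyIntegrable
  intro s hs hsc
  have hs' : ContDiff ℝ (⊤ : ℕ∞) (fun x : ℝ => (s x : ℂ)) := Complex.ofRealCLM.contDiff.comp hs
  have hsc' : HasCompactSupport (fun x : ℝ => (s x : ℂ)) :=
    hsc.comp_left (g := fun y : ℝ => (y : ℂ)) Complex.ofReal_zero
  simpa [Lp.toTemperedDistribution_apply] using h (hsc'.toSchwartzMap hs')

theorem continuous_fourier_of_integrable {f : ℝ → ℂ} (hf : Integrable f) : Continuous (𝓕 f) :=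
  VectorFourier.fourierIntegral_continuous Real.continuous_fourierChar
    (innerSL ℝ).continuous₂ hf

theorem continuous_fourierInv_of_integrable {f : ℝ → ℂ} (hf : Integrable f) :
    Continuous (𝓕⁻ f) := by
  have : 𝓕⁻ f = fun x => 𝓕 f (-x) := funext (Real.fourierInv_eq_fourier_neg f)
  rw [this]
  exact (continuous_fourier_of_integrable hf).comp continuous_neg

theorem integral_fourier_mul_eq_of_integrable {f g : ℝ → ℂ} (hf : Integrable f)
    (hg : Integrable g) : ∫ ξ, 𝓕 f ξ * g ξ = ∫ x, f x * 𝓕 g x := by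
  simpa using! VectorFourier.integral_fourierIntegral_smul_eq_flip (L := innerₗ ℝ)
    Real.continuous_fourierChar continuous_inner hf hg

theorem integral_fourierInv_mul_eq_of_integrable {f g : ℝ → ℂ} (hf : Integrable f)
    (hg : Integrable g) : ∫ ξ, 𝓕⁻ f ξ * g ξ = ∫ x, f x * 𝓕⁻ g x := by
  simp_rw [Real.fourierInv_eq_fourier_neg g]
  rw [Real.fourierInv_eq_fourier_comp_neg, integral_fourier_mul_eq_of_integrable hf.comp_neg hg,
    ← integral_neg_eq_self]
  simp

/-- On `L¹ ∩ L²` the `L²` Fourier transform is given by the Fourier integral. -/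
theorem fourier_ae_eq_of_integrable {f : L2} (hf : Integrable f) :
    (𝓕 f : L2) =ᵐ[volume] 𝓕 (f : ℝ → ℂ) := by
  refine ae_eq_of_forall_integral_schwartz_mul_eq (continuous_fourier_of_integrable hf) fun s => ?_
  rw [← Lp.fourier_toTemperedDistribution_eq, TemperedDistribution.fourier_apply,
    Lp.toTemperedDistribution_apply, ← integral_fourier_mul_eq_of_integrable s.integrable hf]
  simp [SchwartzMap.fourier_coe]

/-- On `L¹ ∩ L²` the inverse `L²` Fourier transform is given by the inverse Fourier integral. -/
theorem fourierInv_ae_eq_of_integrable {f : L2} (hf : Integrable f) :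
    (𝓕⁻ f : L2) =ᵐ[volume] 𝓕⁻ (f : ℝ → ℂ) := by
  refine ae_eq_of_forall_integral_schwartz_mul_eq (continuous_fourierInv_of_integrable hf)
    fun s => ?_
  rw [← Lp.fourierInv_toTemperedDistribution_eq, TemperedDistribution.fourierInv_apply,
    Lp.toTemperedDistribution_apply, ← integral_fourierInv_mul_eq_of_integrable s.integrable hf]
  simp [SchwartzMap.fourierInv_coe]

theorem fourier_conj (f : ℝ → ℂ) (x : ℝ) : 𝓕 (fun ξ => conj (f ξ)) x = conj (𝓕⁻ f x) := by
  rw [Real.fourier_eq', Real.fourierInv_eq', ← integral_conj]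
  congr 1
  ext v
  simp [← Complex.exp_conj, Complex.conj_ofNat]

theorem cauchyPlus_coe (φ : hardyPlus) : cauchyPlus (φ : L2) = φ := by
  ext1
  change 𝓕⁻ (mulOp posIndicator memLp_posIndicator (𝓕 (φ : L2))) = (φ : L2)
  have h : mulOp posIndicator memLp_posIndicator (𝓕 (φ : L2)) = 𝓕 (φ : L2) := by
    apply Lp.ext
    have hφ : ∀ᵐ ξ : ℝ, ξ < 0 → (𝓕 (φ : L2) : L2) ξ = 0 := φ.2
    filter_upwards [mulOp_ae posIndicator memLp_posIndicator (𝓕 (φ : L2)), hφ,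
      Measure.ae_ne volume (0 : ℝ)] with ξ h1 h2 h3
    rw [h1, posIndicator]
    rcases lt_or_gt_of_ne h3 with h | h
    · simp [h2 h]
    · simp [h]
  rw [h, FourierTransform.fourierInv_fourier_eq]

/-- The eigenvalue equation of the Lax operator on the Fourier side. -/
theorem fourier_eigenvector_ae {u : ℝ → ℝ} {hu : MemLp u ∞ volume} {z : ℂ} {φ : hardyPlus}
    (hφ : IsEigenvector (laxOp u hu) z φ) :
    ∀ᵐ ξ : ℝ, 0 < ξ → (2 * Real.pi * ξ - z) * (𝓕 (φ : L2) : L2) ξ =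
      (𝓕 (mulOp (fun x => (u x : ℂ)) hu.ofReal (φ : L2)) : L2) ξ := by
  obtain ⟨-, hdom, heq⟩ := hφ
  have hS : (φ : L2) ∈ sobolevOne := hdom
  set k : L2 := mulOp (fun x => (u x : ℂ)) hu.ofReal (φ : L2) with hk
  have h1 : (1 / Complex.I) • weakDeriv ⟨φ, hS⟩ - (cauchyPlus k : L2) = z • (φ : L2) := by
    have := congrArg (Subtype.val) heq
    refine Eq.trans ?_ this
    change _ = (1 / Complex.I) • weakDeriv ⟨φ, hS⟩ -
      (cauchyPlus (mulOp (fun x => (u x : ℂ)) hu.ofReal (cauchyPlus (φ : L2) : L2)) : L2)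
    rw [cauchyPlus_coe φ]
  have h2 : (1 / Complex.I) • (𝓕 (weakDeriv ⟨φ, hS⟩) : L2) -
      mulOp posIndicator memLp_posIndicator (𝓕 k) = z • (𝓕 (φ : L2) : L2) := by
    have hC : (𝓕 ((cauchyPlus k : L2)) : L2) = mulOp posIndicator memLp_posIndicator (𝓕 k) :=
      FourierTransform.fourier_fourierInv_eq _
    rw [← hC, ← FourierTransform.fourier_smul, ← FourierTransform.fourier_smul, ← h1]
    exact ((Lp.fourierTransformₗᵢ ℝ ℂ).map_sub _ _).symm
  have h3 := Lp.coeFn_sub ((1 / Complex.I) • (𝓕 (weakDeriv ⟨φ, hS⟩) : L2))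
    (mulOp posIndicator memLp_posIndicator (𝓕 k))
  rw [h2] at h3
  filter_upwards [h3, Lp.coeFn_smul z (𝓕 (φ : L2) : L2),
    Lp.coeFn_smul (1 / Complex.I) (𝓕 (weakDeriv ⟨φ, hS⟩) : L2),
    mulOp_ae posIndicator memLp_posIndicator (𝓕 k), fourier_weakDeriv_ae ⟨φ, hS⟩]
    with ξ e1 e2 e3 e4 e5 hξ
  rw [e2, Pi.sub_apply, e3, e4, Pi.smul_apply, Pi.smul_apply, e5, posIndicator,
    Set.indicator_of_mem (by simpa using hξ)] at e1
  simp only [smul_eq_mul, Pi.one_apply, one_mul] at e1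
  have hI : 1 / Complex.I * (2 * Real.pi * Complex.I * ξ * (𝓕 (φ : L2) : L2) ξ) =
      2 * Real.pi * ξ * (𝓕 (φ : L2) : L2) ξ := by
    field_simp
  rw [hI] at e1
  linear_combination -e1

/-- Integration of the derivative of `|h|² / (2πξ - λ)` over the positive half line. -/
theorem norm_sq_apply_zero_eq {h h' : ℝ → ℂ} {lam C : ℝ} (hlam : lam < 0)
    (hd : ∀ ξ, HasDerivAt h (h' ξ) ξ) (hC : ∀ ξ, ‖h ξ‖ ≤ C)
    (hint : IntegrableOn (fun ξ : ℝ => h' ξ * conj (h ξ / (2 * Real.pi * ξ - lam))) (Set.Ioi 0))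
    (hsq : IntegrableOn (fun ξ : ℝ => ‖h ξ / (2 * Real.pi * ξ - lam)‖ ^ 2) (Set.Ioi 0))
    (hre : (∫ ξ : ℝ in Set.Ioi 0, h' ξ * conj (h ξ / (2 * Real.pi * ξ - lam))).re = 0) :
    ‖h 0‖ ^ 2 =
      2 * Real.pi * |lam| * ∫ ξ : ℝ in Set.Ioi 0, ‖h ξ / (2 * Real.pi * ξ - lam)‖ ^ 2 := by
  have hpos : ∀ ξ : ℝ, 0 ≤ ξ → 0 < 2 * Real.pi * ξ - lam := fun ξ hξ => by
    have := Real.pi_pos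
    have : 0 ≤ 2 * Real.pi * ξ := by positivity
    linarith
  have hderiv : ∀ ξ ∈ Set.Ici (0 : ℝ), HasDerivAt (fun ξ => ‖h ξ‖ ^ 2 / (2 * Real.pi * ξ - lam))
      (2 * (h' ξ * conj (h ξ / (2 * Real.pi * ξ - lam))).re -
        2 * Real.pi * ‖h ξ / (2 * Real.pi * ξ - lam)‖ ^ 2) ξ := by
    intro ξ hξ
    have hw := hpos ξ hξ
    have h1 := (hd ξ).norm_sq
    have h2 : HasDerivAt (fun ξ : ℝ => 2 * Real.pi * ξ - lam) (2 * Real.pi) ξ := by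
      simpa using ((hasDerivAt_id ξ).const_mul (2 * Real.pi)).sub_const lam
    refine (h1.div h2 hw.ne').congr_deriv ?_
    have hwc : (2 * Real.pi * ξ - lam : ℂ) = ((2 * Real.pi * ξ - lam : ℝ) : ℂ) := by push_cast; ring
    rw [hwc, map_div₀, Complex.conj_ofReal, ← mul_div_assoc, Complex.div_ofReal_re, norm_div,
      Complex.norm_real, Real.norm_of_nonneg hw.le, Complex.inner]
    field_simp
  have htend : Tendsto (fun ξ : ℝ => ‖h ξ‖ ^ 2 / (2 * Real.pi * ξ - lam)) atTop (𝓝 0) := by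
    have hw : Tendsto (fun ξ : ℝ => 2 * Real.pi * ξ - lam) atTop atTop :=
      tendsto_atTop_add_const_right _ _ (tendsto_id.const_mul_atTop Real.two_pi_pos)
    refine squeeze_zero' ?_ ?_ (hw.const_div_atTop (C ^ 2))
    · filter_upwards [eventually_ge_atTop 0] with ξ hξ
      have := hpos ξ hξ
      positivity
    · filter_upwards [eventually_ge_atTop 0] with ξ hξ
      have := hpos ξ hξ
      gcongr
      exact hC ξ
  have hre' : IntegrableOn
      (fun ξ : ℝ => (h' ξ * conj (h ξ / (2 * Real.pi * ξ - lam))).re) (Set.Ioi 0) := hint.re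
  have key := integral_Ioi_of_hasDerivAt_of_tendsto' hderiv
    ((hre'.const_mul 2).sub (hsq.const_mul (2 * Real.pi))) htend
  have hre0 : ∫ ξ : ℝ in Set.Ioi 0, (h' ξ * conj (h ξ / (2 * Real.pi * ξ - lam))).re = 0 := by
    exact (integral_re hint).trans hre
  rw [integral_sub (hre'.const_mul 2) (hsq.const_mul (2 * Real.pi)), integral_const_mul,
    integral_const_mul, hre0, mul_zero, zero_sub, zero_sub, neg_inj] at key
  rw [abs_of_neg hlam]
  have := hlam.ne
  have e : ‖h 0‖ ^ 2 = -lam * (‖h 0‖ ^ 2 / (2 * Real.pi * 0 - lam)) := by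
    rw [mul_zero, zero_sub, mul_div_cancel₀ _ (neg_ne_zero.2 this)]
  rw [e, ← key]
  ring

theorem integral_norm_sq_eq (f : L2) : ∫ x, ‖f x‖ ^ 2 = ‖f‖ ^ 2 := by
  have h : (inner ℂ f f : ℂ) = ((∫ x, ‖f x‖ ^ 2 : ℝ) : ℂ) := by
    rw [L2.inner_def, ← integral_complex_ofReal]
    congr 1
    ext x
    rw [inner_self_eq_norm_sq_to_K]
    simp
  rw [inner_self_eq_norm_sq_to_K] at h
  refine Complex.ofReal_injective (h.symm.trans ?_)
  simp

theorem memLp_two_inv_linear {lam : ℝ} (hlam : lam < 0) :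
    MemLp (fun ξ : ℝ => (2 * Real.pi * ξ - lam : ℂ)⁻¹) 2 (volume.restrict (Set.Ioi 0)) := by
  have hmeas : Measurable fun ξ : ℝ => (2 * Real.pi * ξ - lam : ℂ)⁻¹ := by fun_prop
  rw [memLp_two_iff_integrable_sq_norm hmeas.aestronglyMeasurable]
  refine Integrable.mono' (g := fun ξ : ℝ => (min 1 (lam ^ 2))⁻¹ * (1 + ξ ^ 2)⁻¹)
    (integrable_inv_one_add_sq.const_mul _).restrict
    (hmeas.norm.pow_const 2).aestronglyMeasurable ?_
  filter_upwards [ae_restrict_mem measurableSet_Ioi] with ξ hξ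
  have hξ : 0 < ξ := hξ
  have hm : 0 < min 1 (lam ^ 2) := lt_min one_pos (sq_pos_of_neg hlam)
  have hwc : (2 * Real.pi * ξ - lam : ℂ) = ((2 * Real.pi * ξ - lam : ℝ) : ℂ) := by push_cast; ring
  rw [Real.norm_of_nonneg (by positivity), hwc, norm_inv, Complex.norm_real, inv_pow,
    Real.norm_eq_abs, sq_abs, ← mul_inv]
  refine inv_anti₀ (by positivity) ?_
  have h1 : min 1 (lam ^ 2) * ξ ^ 2 ≤ 1 * ξ ^ 2 := by gcongr; exact min_le_left _ _
  have h2 : min 1 (lam ^ 2) ≤ lam ^ 2 := min_le_right _ _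
  have h3 : ξ ≤ 2 * Real.pi * ξ := le_mul_of_one_le_left hξ.le (by linarith [Real.two_le_pi])
  have h4 : (ξ - lam) ^ 2 ≤ (2 * Real.pi * ξ - lam) ^ 2 := by gcongr; linarith
  nlinarith [mul_pos hξ (neg_pos.2 hlam)]

theorem re_integral_fourier_mul_conj_eq_zero {u : ℝ → ℝ} {φ : L2}
    (hxu : Integrable fun x : ℝ => (x : ℂ) * ((u x : ℂ) * φ x))
    (hg : Integrable (𝓕 φ : L2)) :
    (∫ ξ, 𝓕 (fun x : ℝ => (-2 * Real.pi * Complex.I * x) • ((u x : ℂ) * φ x)) ξ *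
      conj ((𝓕 φ : L2) ξ)).re = 0 := by
  have hK : Integrable fun x : ℝ => (-2 * Real.pi * Complex.I * x) • ((u x : ℂ) * φ x) := by
    simpa only [smul_eq_mul, mul_assoc] using hxu.const_mul (-2 * Real.pi * Complex.I)
  have hinv : φ =ᵐ[volume] 𝓕⁻ ((𝓕 φ : L2) : ℝ → ℂ) := by
    have := fourierInv_ae_eq_of_integrable hg
    rwa [FourierTransform.fourierInv_fourier_eq] at this
  have hcg : Integrable fun ξ => conj ((𝓕 φ : L2) ξ) :=
    (LinearIsometryEquiv.integrable_comp_iff Complex.conjLIE).2 hg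
  rw [integral_fourier_mul_eq_of_integrable hK hcg]
  have hcongr : ∫ x : ℝ, (-2 * Real.pi * Complex.I * x) • ((u x : ℂ) * φ x) *
      𝓕 (fun ξ => conj ((𝓕 φ : L2) ξ)) x =
      ∫ x : ℝ, Complex.I * ((-2 * Real.pi * x * u x * ‖φ x‖ ^ 2 : ℝ) : ℂ) := by
    apply integral_congr_ae
    filter_upwards [hinv] with x hx
    rw [fourier_conj, ← hx, smul_eq_mul]
    have := Complex.mul_conj' (φ x)
    push_cast
    rw [← this]
    ring
  rw [hcongr, integral_const_mul, integral_complex_ofReal]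
  simp

end BenjaminOno

theorem mainTheorem2 (u : ℝ → ℝ) (hu2 : MemLp u 2 volume) (huTop : MemLp u ∞ volume)
    (hxu : MemLp (fun x : ℝ => x * u x) 2 volume)
    (lam : ℝ) (hlam : lam < 0) (φ : BenjaminOno.hardyPlus)
    (hφ : BenjaminOno.IsEigenvector (BenjaminOno.laxOp u huTop) (lam : ℂ) φ) :
    Integrable (fun x : ℝ => (u x : ℂ) * (φ : BenjaminOno.L2) x) volume ∧
    ‖(∫ x : ℝ, (u x : ℂ) * (φ : BenjaminOno.L2) x)‖ ^ 2 =
      2 * Real.pi * |lam| * (∫ x : ℝ, ‖(φ : BenjaminOno.L2) x‖ ^ 2) ∧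
    (∫ x : ℝ, (u x : ℂ) * (φ : BenjaminOno.L2) x) ≠ 0 := by
  open BenjaminOno ComplexConjugate in
  have hF : Integrable (fun x : ℝ => (u x : ℂ) * (φ : L2) x) :=
    hu2.ofReal.integrable_mul (Lp.memLp (φ : L2))
  have hxF : Integrable (fun x : ℝ => (x : ℂ) * ((u x : ℂ) * (φ : L2) x)) := by
    refine (hxu.ofReal.integrable_mul (Lp.memLp (φ : L2))).congr (ae_of_all _ fun x => ?_)
    simp [mul_assoc]
  set F : ℝ → ℂ := fun x => (u x : ℂ) * (φ : L2) x with hFdef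
  set k : L2 := mulOp (fun x => (u x : ℂ)) huTop.ofReal (φ : L2) with hk
  set g : L2 := 𝓕 (φ : L2) with hgdef
  have hkF : k =ᵐ[volume] F := mulOp_ae _ _ _
  have hkh : (𝓕 k : L2) =ᵐ[volume] 𝓕 F :=
    (fourier_ae_eq_of_integrable (hF.congr hkF.symm)).trans
      (ae_of_all _ fun ξ => Real.fourier_congr_ae hkF ξ)
  have hgG : g =ᵐ[volume]
      (Set.Ioi 0).indicator fun ξ : ℝ => 𝓕 F ξ / (2 * Real.pi * ξ - lam : ℂ) := by
    have hneg : ∀ᵐ ξ : ℝ, ξ < 0 → g ξ = 0 := φ.2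
    filter_upwards [fourier_eigenvector_ae hφ, hneg, hkh, Measure.ae_ne volume (0 : ℝ)]
      with ξ h1 h2 h3 h4
    rcases lt_or_gt_of_ne h4 with h | h
    · rw [h2 h, Set.indicator_of_notMem (by simpa using h.le)]
    · rw [Set.indicator_of_mem (by simpa using h), ← h3, ← h1 h, mul_div_cancel_left₀]
      have : (0 : ℝ) < 2 * Real.pi * ξ - lam := by
        have := mul_pos Real.two_pi_pos h
        linarith
      exact_mod_cast this.ne'
  have hG : IntegrableOn (fun ξ : ℝ => 𝓕 F ξ / (2 * Real.pi * ξ - lam : ℂ)) (Set.Ioi 0) :=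
    (((memLp_congr_ae hkh).1 (Lp.memLp (𝓕 k : L2))).restrict _).integrable_mul
      (memLp_two_inv_linear hlam)
  have hg : Integrable g := ((integrable_indicator_iff measurableSet_Ioi).2 hG).congr hgG.symm
  have hK : Integrable fun x : ℝ => (-2 * Real.pi * Complex.I * x) • F x := by
    simpa only [smul_eq_mul, mul_assoc] using hxF.const_mul (-2 * Real.pi * Complex.I)
  set h' : ℝ → ℂ := 𝓕 (fun x : ℝ => (-2 * Real.pi * Complex.I * x) • F x) with hh'
  have hbdd : ∀ {f : ℝ → ℂ} (ξ : ℝ), ‖𝓕 f ξ‖ ≤ ∫ x, ‖f x‖ := fun ξ =>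
    VectorFourier.norm_fourierIntegral_le_integral_norm _ _ _ _ _
  have hprod : (Set.Ioi 0).indicator
      (fun ξ : ℝ => h' ξ * conj (𝓕 F ξ / (2 * Real.pi * ξ - lam : ℂ))) =ᵐ[volume]
      fun ξ => h' ξ * conj (g ξ) := by
    filter_upwards [hgG] with ξ hξ
    rw [hξ]
    by_cases h : ξ ∈ Set.Ioi (0 : ℝ) <;> simp [h]
  have hsqG : (Set.Ioi 0).indicator
      (fun ξ : ℝ => ‖𝓕 F ξ / (2 * Real.pi * ξ - lam : ℂ)‖ ^ 2) =ᵐ[volume]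
      fun ξ => ‖g ξ‖ ^ 2 := by
    filter_upwards [hgG] with ξ hξ
    rw [hξ]
    by_cases h : ξ ∈ Set.Ioi (0 : ℝ) <;> simp [h]
  have hcg : Integrable fun ξ => conj (g ξ) :=
    (LinearIsometryEquiv.integrable_comp_iff Complex.conjLIE).2 hg
  have hint : Integrable fun ξ => h' ξ * conj (g ξ) :=
    hcg.bdd_mul (continuous_fourier_of_integrable hK).aestronglyMeasurable
      (ae_of_all _ fun ξ => hbdd ξ)
  have main := norm_sq_apply_zero_eq hlam
    (fun ξ => Real.hasDerivAt_fourier hF (by simpa using hxF) ξ) (fun ξ => hbdd ξ)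
    ((integrable_indicator_iff measurableSet_Ioi).1 (hint.congr hprod.symm))
    ((integrable_indicator_iff measurableSet_Ioi).1
      (((Lp.memLp g).integrable_norm_pow two_ne_zero).congr hsqG.symm))
    (by
      rw [← integral_indicator measurableSet_Ioi, integral_congr_ae hprod]
      exact re_integral_fourier_mul_conj_eq_zero hxF hg)
  have h0 : 𝓕 F 0 = ∫ x, F x := by simp [Real.fourier_eq]
  rw [h0, ← integral_indicator measurableSet_Ioi, integral_congr_ae hsqG, integral_norm_sq_eq,
    hgdef, Lp.norm_fourier_eq] at main
  refine ⟨hF, by rw [main, integral_norm_sq_eq], fun hzero => ?_⟩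
  rw [hzero, norm_zero, zero_pow two_ne_zero] at main
  have hφ0 : (φ : L2) ≠ 0 := fun h => hφ.1 (Subtype.ext h)
  have : 0 < 2 * Real.pi * |lam| * ‖(φ : L2)‖ ^ 2 :=
    mul_pos (mul_pos Real.two_pi_pos (abs_pos.2 hlam.ne)) (pow_pos (norm_pos_iff.2 hφ0) 2)
  exact this.ne main
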